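/- **Setting.** Let $T\ge 1$ be a finite horizon, $\gamma\in(0,1]$ a discount factor ($\gamma=1$ is the undiscounted problem), $\mathcal S$ a finite state set and, for each $s\in\mathcal S$, $\mathcal A_s$ a finite nonempty action set. Each state belongs to exactly one stage, $\mathcal S=\bigsqcup_{t=1}^T\mathcal S_t$, and $\mathcal S_1=\{s_1\}$. The uncertain parameters of $s$ are $(\boldsymbol p_s,\boldsymbol r_s)=\big((p(s'|s,a))_{a\in\mathcal A_s,s'\in\mathcal S},(r(s,a))_{a\in\mathcal A_s}\big)\in E_s:=\mathbb R^{\mathcal A_s\times\mathcal S}\times\mathbb R^{\mathcal A_s}$. No reward is received at stage $T$. **Ambiguity sets.** For each $s$ we are given $N_s,J_s\in\mathbb N$ and, for $j\in[J_s]$, a nonempty set $\mathcal N_j\subseteq[N_s]$, a number $M_j\in\mathbb N$, and functions $\boldsymbol g_{jn}:E_s\to\mathbb R^{M_j}$ ($n\in\mathcal N_j$) that are componentwise convex and lower semicontinuous; compact convex sets $\mathcal D_n\subseteq E_s$ ($n\in[N_s]$) and $\mathcal U_j\subseteq E_s\times\mathbb R^{M_j}$ ($j\in[J_s]$); and a compact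 convex set $\mathcal W\subseteq\{\boldsymbol\omega\in\mathbb R^{N_s}:\omega_n>0\ \forall n,\ \sum_n\omega_n=1\}$ (all these data may depend on $s$). The lifted ambiguity set $\mathcal G_s$ is the set of Borel probability laws $\mathbb P$ of $(\tilde{\boldsymbol p}_s,\tilde{\boldsymbol r}_s,\tilde n_s)$ on $E_s\times[N_s]$ such that, for some $\boldsymbol\omega\in\mathcal W$ and $(\boldsymbol\mu_j,\boldsymbol\nu_j)\in\mathcal U_j$, $$\mathbb E_{\mathbb P}[(\tilde{\boldsymbol p}_s,\tilde{\boldsymbol r}_s)\mid\tilde n_s\in\mathcal N_j]=\boldsymbol\mu_j,\qquad \mathbb E_{\mathbb P}[\boldsymbol g_{j\tilde n_s}(\tilde{\boldsymbol p}_s,\tilde{\boldsymbol r}_s)\mid\tilde n_s\in\mathcal N_j]\le\boldsymbol\nu_j\qquad(j\in[J_s]),$$ $$\mathbb P[(\tilde{\boldsymbol p}_s,\tilde{\boldsymbol r}_s)\in\mathcal D_n\mid\tilde n_s=n]=1,\qquad \mathbb P[\tilde n_s=n]=\omega_n\qquad(n\in[N_s]).$$ We assume $\mathcal G_s\neq\emptyset$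 for all $s$, and that for $s\in\mathcal S_t$, $t<T$, every $(\boldsymbol p_s,\boldsymbol r_s)\in\mathcal D_n$ is such that each $p(\cdot|s,a)$ is a probability vector on $\mathcal S$ which vanishes outside $\mathcal S_{t+1}$. Put $\mathcal G_{\mathcal S}=\{\bigotimes_{s\in\mathcal S}\mathbb P_s:\ \mathbb P_s\in\mathcal G_s\ \forall s\}$. **Policies and reward.** $\Pi^{\rm HR}$ is the set of history-dependent randomized policies: at time $t=1,\dots,T-1$, given $t-1$ previous state-action pairs and the current state $s$, a policy $\pi$ prescribes a probability vector on $\mathcal A_s$. Let $u(\pi,\boldsymbol p,\boldsymbol r,s_1)$ be the expectation of $\sum_{t=1}^{T-1}\gamma^{t-1}r(s_t,a_t)$ when the process starts in $s_1$, actions are drawn by $\pi$ and transitions by $\boldsymbol p$, and let $w(\pi,\mathbb P,s_1)=\mathbb E_{\mathbb P}[u(\pi,\tilde{\boldsymbol p},\tilde{\boldsymbol r},s_1)]$. **$\mathcal S$-robust strategies.** Put $v_T(s)=0$ for $s\in\mathcal S_T$ and, backwards for $t<T$ and $s\in\mathcal S_t$, $v_t(s)=\max_{\boldsymbol\pi_s\in\mathcal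 P(\mathcal A_s)}\inf_{\mathbb P\in\mathcal G_s}\Phi_s(\boldsymbol\pi_s,\mathbb P)$, where $\mathcal P(\mathcal A_s)$ is the set of probability vectors on $\mathcal A_s$ and $$\Phi_s(\boldsymbol\pi_s,\mathbb P)=\mathbb E_{\mathbb P}\Big[\sum_{a\in\mathcal A_s}\pi_s(a)\Big(\tilde r(s,a)+\gamma\sum_{s'\in\mathcal S_{t+1}}\tilde p(s'|s,a)v_{t+1}(s')\Big)\Big].$$ A policy $\pi^*\in\Pi^{\rm HR}$ is an $\mathcal S$-robust strategy if, for all $t<T$, all $s\in\mathcal S_t$ and every history at time $t$ ending at $s$, the distribution it prescribes is a maximizer of $\inf_{\mathbb P\in\mathcal G_s}\Phi_s(\cdot,\mathbb P)$ over $\mathcal P(\mathcal A_s)$. **Theorem.** If $\pi^*$ is an $\mathcal S$-robust strategy, then: 1. $\pi^*$ is distributionally robust with respect to $\mathcal G_{\mathcal S}$: for all $\pi\in\Pi^{\rm HR}$, $\ \inf_{\mathbb P\in\mathcal G_{\mathcal S}}w(\pi,\mathbb P,s_1)\le\inf_{\mathbb P\in\mathcal G_{\mathcal S}}w(\pi^*,\mathbb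 P,s_1)$. 2. There is $\mathbb P^*\in\mathcal G_{\mathcal S}$ such that $(\pi^*,\mathbb P^*)$ is a saddle point: $$\max_{\pi\in\Pi^{\rm HR}}w(\pi,\mathbb P^*,s_1)=w(\pi^*,\mathbb P^*,s_1)=\inf_{\mathbb P\in\mathcal G_{\mathcal S}}w(\pi^*,\mathbb P,s_1).$$ -/

import Mathlib

open MeasureTheory ProbabilityTheory

noncomputable section

namespace RobustMDP

universe u v

/-- The uncertain parameters `(p_s, r_s)` attached to one state with action set `A`: `x.1 a s'` is
the probability of moving to `s'` under the action `a`, and `x.2 a` is the reward of `a`. -/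
abbrev Param (S : Type u) (A : Type v) : Type (max u v) := (A → S → ℝ) × (A → ℝ)

/-- The data of a lifted ambiguity set in the general format, for one state with action set `A`. -/
structure LiftedFormat (S : Type u) (A : Type v) where
  /-- number of scenarios, the auxiliary variable `ñ` takes values in `Fin N` -/
  N : ℕ
  /-- number of conditional moment conditions -/
  J : ℕ
  /-- scenario set of the `j`-th moment condition -/
  scen : Fin J → Set (Fin N)
  /-- number of generalized moments in the `j`-th condition -/
  M : Fin J → ℕ
  /-- generalized moment functions -/
  g : (j : Fin J) → Fin N → Param S A → (Fin (M j) → ℝ)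
  /-- scenario-wise support sets -/
  D : Fin N → Set (Param S A)
  /-- uncertainty sets of the moment values `(μ_j, ν_j)` -/
  U : (j : Fin J) → Set (Param S A × (Fin (M j) → ℝ))
  /-- uncertainty set of the scenario probabilities -/
  W : Set (Fin N → ℝ)
  scen_nonempty : ∀ j, (scen j).Nonempty
  g_convex : ∀ j, ∀ n ∈ scen j, ∀ m, ConvexOn ℝ Set.univ (fun x => g j n x m)
  g_lsc : ∀ j, ∀ n ∈ scen j, ∀ m, LowerSemicontinuous (fun x => g j n x m)
  D_convex : ∀ n, Convex ℝ (D n)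
  D_compact : ∀ n, IsCompact (D n)
  U_convex : ∀ j, Convex ℝ (U j)
  U_compact : ∀ j, IsCompact (U j)
  W_convex : Convex ℝ W
  W_compact : IsCompact W
  W_subset : W ⊆ {ω | (∀ n, 0 < ω n) ∧ ∑ n, ω n = 1}

namespace LiftedFormat

variable {S : Type u} {A : Type v} [Fintype S] [Fintype A]

/-- The lifted ambiguity set: the joint laws `P` of `((p, r), ñ)` which satisfy the constraints of
the general format for some `ω ∈ W` and `(μ_j, ν_j) ∈ U_j`. (All integrands are bounded almost
surely, because of the support constraint.) -/
def ambiguity (F : LiftedFormat S A) : Set (Measure (Param S A × Fin F.N)) :=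
  {P | IsProbabilityMeasure P ∧
    ∃ ω ∈ F.W, ∃ μν : (j : Fin F.J) → Param S A × (Fin (F.M j) → ℝ), (∀ j, μν j ∈ F.U j) ∧
      (∀ j, ∫ x, x.1 ∂P[|{x | x.2 ∈ F.scen j}] = (μν j).1) ∧
      (∀ j m, ∫ x, F.g j x.2 x.1 m ∂P[|{x | x.2 ∈ F.scen j}] ≤ (μν j).2 m) ∧
      (∀ n, P[|{x | x.2 = n}] {x | x.1 ∈ F.D n} = 1) ∧
      (∀ n, P.real {x | x.2 = n} = ω n)}

end LiftedFormat

/-- A distributionally robust MDP with finite horizon and stage-layered states. There are `H + 1`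
stages, numbered `0, …, H` (so `T = H + 1`); decisions are taken at the stages `0, …, H - 1`, and no
reward is received at the last stage `H`. The value `γ = 1` gives the undiscounted problem. -/
structure DRMDP (S : Type u) (A : S → Type v) [Fintype S] [∀ s, Fintype (A s)] where
  H : ℕ
  γ : ℝ
  γ_pos : 0 < γ
  γ_le_one : γ ≤ 1
  /-- the unique stage to which a state belongs -/
  stage : S → Fin (H + 1)
  /-- the initial state -/
  s₁ : S
  /-- the first stage consists of the initial state only -/
  stage_eq_zero_iff : ∀ s, stage s = 0 ↔ s = s₁
  /-- the lifted ambiguity set of each state, in the general format -/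
  fmt : (s : S) → LiftedFormat S (A s)
  /-- before the last stage, the support only contains parameters whose `p` part is a transition
  probability to the states of the next stage -/
  support_admissible : ∀ s, (stage s : ℕ) < H → ∀ n, ∀ x ∈ (fmt s).D n, ∀ a : A s,
    (∀ s', 0 ≤ x.1 a s') ∧ ∑ s', x.1 a s' = 1 ∧
      ∀ s', (stage s' : ℕ) ≠ stage s + 1 → x.1 a s' = 0

namespace DRMDP

variable {S : Type u} {A : S → Type v} [Fintype S] [∀ s, Fintype (A s)]

/-- Sample space of the parameters and the auxiliary variables of all states. -/
abbrev Omega (M : DRMDP S A) : Type (max u v) :=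
  (s : S) → Param S (A s) × Fin (M.fmt s).N

/-- The s-rectangular lifted ambiguity set: products of members of the state-wise sets. -/
def ambiguity (M : DRMDP S A) : Set (Measure M.Omega) :=
  {P | ∃ Q : (s : S) → Measure (Param S (A s) × Fin (M.fmt s).N),
    (∀ s, Q s ∈ (M.fmt s).ambiguity) ∧ P = Measure.pi Q}

/-- History-dependent randomized policies: at stage `t`, given the `t` previous state-action pairs
and the current state `s`, a probability vector on the actions available in `s`. -/
abbrev Policy (M : DRMDP S A) : Type (max u v) :=
  (t : Fin M.H) → (Fin t → Σ s, A s) → (s : S) → stdSimplex ℝ (A s)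

/-- Trajectories: `H` state-action pairs followed by a terminal state. -/
abbrev Traj (M : DRMDP S A) : Type (max u v) := (Fin M.H → Σ s, A s) × S

/-- The state visited at stage `t`. -/
def stateAt (M : DRMDP S A) (τ : M.Traj) : Fin (M.H + 1) → S :=
  Fin.snoc (α := fun _ => S) (fun t => (τ.1 t).1) τ.2

/-- The state-action pairs preceding stage `t`. -/
def past (M : DRMDP S A) (τ : M.Traj) (t : Fin M.H) : Fin t → Σ s, A s :=
  fun i => τ.1 ⟨i, i.2.trans t.2⟩

open Classical in
/-- The probability of a trajectory started at `s₁`, under the policy `π` and the transition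
probabilities `p`. -/
def trajProb (M : DRMDP S A) (π : M.Policy) (p : (s : S) → A s → S → ℝ) (τ : M.Traj) : ℝ :=
  (if M.stateAt τ 0 = M.s₁ then 1 else 0) *
    ∏ t : Fin M.H, (π t (M.past τ t) (τ.1 t).1 : A (τ.1 t).1 → ℝ) (τ.1 t).2 *
      p (τ.1 t).1 (τ.1 t).2 (M.stateAt τ t.succ)

/-- The expected total reward `u(π, p, r, s₁)`, the terminal reward being zero. -/
def totalReward (M : DRMDP S A) (π : M.Policy) (p : (s : S) → A s → S → ℝ)
    (r : (s : S) → A s → ℝ) : ℝ :=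
  ∑ τ : M.Traj, M.trajProb π p τ * ∑ t : Fin M.H, M.γ ^ (t : ℕ) * r (τ.1 t).1 (τ.1 t).2

/-- `w(π, P, s₁) = E_P[u(π, p, r, s₁)]`. -/
def w (M : DRMDP S A) (π : M.Policy) (P : Measure M.Omega) : ℝ :=
  ∫ ξ, M.totalReward π (fun s => (ξ s).1.1) (fun s => (ξ s).1.2) ∂P

/-- Distributionally robust policies: they maximize the worst-case expected total reward over all
history-dependent randomized policies. -/
def IsDistributionallyRobust (M : DRMDP S A) (π' : M.Policy) : Prop :=
  ∀ π : M.Policy, (⨅ P : M.ambiguity, M.w π P) ≤ ⨅ P : M.ambiguity, M.w π' P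

/-- `∑_a π_s(a) (r(s, a) + γ ∑_{s'} p(s' | s, a) v(s'))`, with `s'` in the stage after that
of `s`. -/
def stageReward (M : DRMDP S A) (v : S → ℝ) (s : S) (ρ : stdSimplex ℝ (A s))
    (x : Param S (A s)) : ℝ :=
  ∑ a, (ρ : A s → ℝ) a *
    (x.2 a + M.γ * ∑ s' with (M.stage s' : ℕ) = M.stage s + 1, x.1 a s' * v s')

/-- The worst-case expectation of the stage reward over the ambiguity set of `s`. -/
def worstStage (M : DRMDP S A) (v : S → ℝ) (s : S) (ρ : stdSimplex ℝ (A s)) : ℝ :=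
  ⨅ P : (M.fmt s).ambiguity, ∫ x, M.stageReward v s ρ x.1 ∂P.1

/-- The `S`-robust values, by backward induction; `M.robustValue k s` is the `S`-robust value of a
state `s` with `k` decisions to go, that is, a state of the stage `H - k`. -/
def robustValue (M : DRMDP S A) : ℕ → S → ℝ
  | 0 => fun _ => 0
  | k + 1 => fun s => ⨆ ρ : stdSimplex ℝ (A s), M.worstStage (M.robustValue k) s ρ

/-- `S`-robust randomized actions at a state `s` before the last stage. -/
def IsRobustAction (M : DRMDP S A) (s : S) (ρ : stdSimplex ℝ (A s)) : Prop :=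
  ∀ ρ' : stdSimplex ℝ (A s),
    M.worstStage (M.robustValue (M.H - (M.stage s + 1))) s ρ' ≤
      M.worstStage (M.robustValue (M.H - (M.stage s + 1))) s ρ

/-- `S`-robust strategies: after every history ending at a state `s` of stage `t`, the policy
prescribes an `S`-robust randomized action. -/
def IsSRobust (M : DRMDP S A) (π : M.Policy) : Prop :=
  ∀ (t : Fin M.H) (h : Fin t → Σ s, A s) (s : S), M.stage s = t.castSucc →
    M.IsRobustAction s (π t h s)

end DRMDP

end RobustMDP

end

/-! Only the means of the parameters matter. The MDP is layered, so no state is visited twice, and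
under a product law the parameters of a state are independent of the reward to go after it. Hence `w
π (Measure.pi Q)` is the policy evaluation recursion at the mean parameters (`integral_value`,
`w_pi`), and each ambiguity set may be replaced by its set of means, `meanSet`. Jensen's inequality
shows that replacing the law in each scenario by a point mass at its mean keeps all constraints. So
`meanSet` is described by finitely many vectors, and it is compact (`isCompact_meanSet`) and convex
(`convex_meanSet`). At each state before the last stage, separation then yields mean parameters
against which no action earns more than the robust value (`exists_actionReward_le`). Laws with these
means, multiplied over the states, form `Pstar`. With `V` the robust value of the initial state, two
backward inductions give `w π Pstar ≤ V ≤ w πstar P` for every policy `π` and every law `P` of the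
ambiguity set. Both claims follow from this chain. -/

noncomputable section

namespace RobustMDP

universe u v

/-! ### Minimax by separation -/

/-- One half of the minimax theorem for a payoff that is linear in both arguments. -/
theorem exists_forall_le_of_forall_stdSimplex {E A : Type*} [NormedAddCommGroup E]
    [NormedSpace ℝ E] [Fintype A] {K : Set E} (hK : IsCompact K)
    (hconv : Convex ℝ K) (hne : K.Nonempty) (c : E →L[ℝ] (A → ℝ)) (v : ℝ)
    (hv : ∀ ρ ∈ stdSimplex ℝ A, ∃ m ∈ K, ∑ a, ρ a * c m a ≤ v) :
    ∃ m ∈ K, ∀ a, c m a ≤ v := by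
  classical
  by_contra! hcon
  have hO : IsClosed {y : A → ℝ | ∀ a, y a ≤ v} := by
    simp only [Set.ofPred_forall]
    exact isClosed_iInter fun a => isClosed_le (continuous_apply a) continuous_const
  have hOc : Convex ℝ {y : A → ℝ | ∀ a, y a ≤ v} := by
    intro x hx y hy α β hα hβ hαβ a
    have h1 := mul_le_mul_of_nonneg_left (hx a) hα
    have h2 := mul_le_mul_of_nonneg_left (hy a) hβ
    have h3 : α * v + β * v = v := by rw [← add_mul, hαβ, one_mul]
    simp only [Pi.add_apply, Pi.smul_apply, smul_eq_mul]
    linarith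
  have hdisj : Disjoint (c '' K) {y : A → ℝ | ∀ a, y a ≤ v} := by
    rw [Set.disjoint_left]
    rintro _ ⟨m, hm, rfl⟩ h
    obtain ⟨a, ha⟩ := hcon m hm
    exact absurd (h a) (not_le.mpr ha)
  -- If the claim fails, the compact convex image of `K` misses the closed orthant of vectors
  -- bounded by `v`. The normal of a separating hyperplane, with its sign reversed and normalized,
  -- is a mixed action contradicting `hv`.
  obtain ⟨f, p, q, hp, hpq, hq⟩ := geometric_hahn_banach_compact_closed
    (hconv.linear_image c.toLinearMap) (hK.image c.continuous) hOc hO hdisj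
  set l : A → ℝ := fun a => -f (Pi.single a 1) with hl
  have hf : ∀ y, f y = -∑ a, l a * y a := by
    intro y
    conv_lhs => rw [← Finset.univ_sum_single y, map_sum]
    rw [← Finset.sum_neg_distrib]
    refine Finset.sum_congr rfl fun a _ => ?_
    have : (Pi.single a (y a) : A → ℝ) = y a • Pi.single a 1 := by
      rw [← Pi.single_smul, smul_eq_mul, mul_one]
    rw [this, map_smul, smul_eq_mul, hl]
    ring
  have hlnn : ∀ a, 0 ≤ l a := by
    intro a
    by_contra! ha
    set z := f (fun _ => v) with hz
    have hzq : q < z := hq _ fun _ => le_rfl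
    -- With a negative weight `l a`, moving down the coordinate `a` stays in the orthant and
    -- decreases `f`. This step length brings `f` down to exactly `q`, although `f > q` on the
    -- orthant.
    set k : ℝ := (z - q) / (-l a) with hk
    have hk0 : 0 ≤ k := div_nonneg (by linarith) (by linarith)
    have h1 := hq ((fun _ => v) + (-k) • Pi.single a 1) (by
      intro b
      by_cases hb : b = a
      · subst hb; simpa using hk0
      · simp [hb])
    rw [map_add, map_smul, smul_eq_mul] at h1
    have h2 : f (Pi.single a 1) = -l a := by simp [hl]
    have h3 : k * (-l a) = z - q := by
      rw [hk, div_mul_cancel₀ _ (by linarith)]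
    rw [h2] at h1
    linarith
  obtain ⟨m₀, hm₀⟩ := hne
  -- If all weights were zero, `f` would vanish and could not separate: `K` is nonempty.
  have hlsum : 0 < ∑ a, l a := by
    refine lt_of_le_of_ne (Finset.sum_nonneg fun a _ => hlnn a) fun h => ?_
    have hz : ∀ a, l a = 0 := fun a =>
      (Finset.sum_eq_zero_iff_of_nonneg fun a _ => hlnn a).mp h.symm a (Finset.mem_univ a)
    have h1 := hp _ ⟨m₀, hm₀, rfl⟩
    have h2 := hq (fun _ => v) fun _ => le_rfl
    rw [hf] at h1 h2
    simp only [hz, zero_mul, Finset.sum_const_zero, neg_zero] at h1 h2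
    linarith
  obtain ⟨m, hm, hmv⟩ := hv (fun a => l a / ∑ b, l b)
    ⟨fun a => div_nonneg (hlnn a) hlsum.le, by rw [← Finset.sum_div, div_self hlsum.ne']⟩
  have h1 : f (c m) < p := hp _ ⟨m, hm, rfl⟩
  have h2 := hq (fun _ => v) fun _ => le_rfl
  rw [hf] at h1 h2
  rw [← Finset.sum_mul, mul_comm] at h2
  have h3 : ∑ a, l a / (∑ b, l b) * c m a = (∑ a, l a * c m a) / ∑ b, l b := by
    rw [Finset.sum_div]
    exact Finset.sum_congr rfl fun a _ => by ring
  rw [h3, div_le_iff₀ hlsum] at hmv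
  linarith

/-! ### The set of mean parameters: compactness and convexity -/

namespace LiftedFormat

variable {S : Type u} {A : Type v} [Fintype S] [Fintype A]

/-- A finite convex function on a whole finite-dimensional space is continuous. This makes the
moment constraints closed and the moments integrable over the compact supports. -/
theorem continuous_g (F : LiftedFormat S A) {j : Fin F.J} {n : Fin F.N} (hn : n ∈ F.scen j)
    (m : Fin (F.M j)) : Continuous fun x => F.g j n x m :=
  continuousOn_univ.mp ((F.g_convex j n hn m).continuousOn isOpen_univ)

open Classical in
/-- `F.IsScenarioMean (ω, m, μν)`: the scenario probabilities `ω`, the scenario-wise means `m` and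
the moment values `μν` satisfy the constraints of the general format, when the law in each scenario
`n` is concentrated at `m n`. -/
def IsScenarioMean (F : LiftedFormat S A) (z : (Fin F.N → ℝ) × (Fin F.N → Param S A) ×
    ((j : Fin F.J) → Param S A × (Fin (F.M j) → ℝ))) : Prop :=
  (z.1 ∈ F.W ∧ (∀ n, z.2.1 n ∈ F.D n) ∧ ∀ j, z.2.2 j ∈ F.U j) ∧
    (∀ j, ∑ n with n ∈ F.scen j, z.1 n • z.2.1 n =
      (∑ n with n ∈ F.scen j, z.1 n) • (z.2.2 j).1) ∧
    ∀ j i, ∑ n with n ∈ F.scen j, z.1 n * F.g j n (z.2.1 n) i ≤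
      (∑ n with n ∈ F.scen j, z.1 n) * (z.2.2 j).2 i

/-- The set of the means of the parameters under the laws of the ambiguity set. -/
def meanSet (F : LiftedFormat S A) : Set (Param S A) :=
  (fun z => ∑ n, z.1 n • z.2.1 n) '' {z | F.IsScenarioMean z}

/-- The admissible triples form a closed subset of a product of compact sets, because the
constraints are written without dividing by the scenario probabilities. The mean is a continuous
image of them. -/
theorem isCompact_meanSet (F : LiftedFormat S A) : IsCompact F.meanSet := by
  classical
  refine IsCompact.image ?_ (by fun_prop)
  have hc : IsCompact (F.W ×ˢ (Set.univ.pi F.D ×ˢ Set.univ.pi F.U)) :=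
    F.W_compact.prod ((isCompact_univ_pi F.D_compact).prod (isCompact_univ_pi F.U_compact))
  refine hc.of_isClosed_subset ?_ ?_
  · have : {z | F.IsScenarioMean z} = (F.W ×ˢ (Set.univ.pi F.D ×ˢ Set.univ.pi F.U)) ∩
        ((⋂ j, {z | ∑ n with n ∈ F.scen j, z.1 n • z.2.1 n =
          (∑ n with n ∈ F.scen j, z.1 n) • (z.2.2 j).1}) ∩
        ⋂ j, ⋂ i, {z | ∑ n with n ∈ F.scen j, z.1 n * F.g j n (z.2.1 n) i ≤
          (∑ n with n ∈ F.scen j, z.1 n) * (z.2.2 j).2 i}) := by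
      ext z
      simp [IsScenarioMean, Set.mem_pi]
    rw [this]
    refine hc.isClosed.inter (IsClosed.inter ?_ ?_)
    · exact isClosed_iInter fun j => isClosed_eq (by fun_prop) (by fun_prop)
    · refine isClosed_iInter fun j => isClosed_iInter fun i => isClosed_le ?_ (by fun_prop)
      refine continuous_finsetSum _ fun n hn => ?_
      have hg := F.continuous_g (Finset.mem_filter.mp hn).2 i
      exact (by fun_prop : Continuous fun z : (Fin F.N → ℝ) × (Fin F.N → Param S A) ×
        ((j : Fin F.J) → Param S A × (Fin (F.M j) → ℝ)) => z.1 n).mul (hg.comp (by fun_prop))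
  · rintro z ⟨⟨h1, h2, h3⟩, -⟩
    exact ⟨h1, fun n _ => h2 n, fun j _ => h3 j⟩

omit [Fintype S] [Fintype A] in
theorem IsScenarioMean.pos {F : LiftedFormat S A} {z} (hz : F.IsScenarioMean z) (n : Fin F.N) :
    0 < z.1 n := (F.W_subset hz.1.1).1 n

theorem convex_smul_mem {E : Type*} [AddCommGroup E] [Module ℝ E] {K : Set E}
    (hK : Convex ℝ K) {x y : E} (hx : x ∈ K) (hy : y ∈ K) {a b : ℝ} (ha : 0 ≤ a) (hb : 0 ≤ b)
    (hab : 0 < a + b) : (a + b)⁻¹ • (a • x + b • y) ∈ K := by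
  rw [smul_add, smul_smul, smul_smul]
  refine hK hx hy (by positivity) (by positivity) ?_
  field_simp

-- The constraints are bilinear, so admissible triples cannot be averaged componentwise. Averaging
-- the products `ω n • m n` and dividing by the new probability works instead: each new `m n` is a
-- convex combination with weights proportional to `α * ω n` and `β * ω' n`, and each new moment
-- value is weighted likewise by the mass of its scenario set. The equalities become linear, and the
-- inequalities survive because the perspective of a convex function is convex. All divisors are
-- positive since `W` consists of positive vectors and the scenario sets are nonempty.
omit [Fintype S] [Fintype A] in
theorem convex_meanSet (F : LiftedFormat S A) : Convex ℝ F.meanSet := by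
  classical
  rintro _ ⟨z, hz, rfl⟩ _ ⟨z', hz', rfl⟩ α β hα hβ hαβ
  have hpos : ∀ n, 0 < α * z.1 n + β * z'.1 n := fun n =>
    (F.W_subset (F.W_convex hz.1.1 hz'.1.1 hα hβ hαβ)).1 n
  have hO : ∀ j, 0 < ∑ n with n ∈ F.scen j, (α * z.1 n + β * z'.1 n) := fun j => by
    obtain ⟨n, hn⟩ := F.scen_nonempty j
    exact Finset.sum_pos (fun n _ => hpos n) ⟨n, by simpa using hn⟩
  set O : Fin F.J → ℝ := fun j => ∑ n with n ∈ F.scen j, z.1 n with hOdef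
  set O' : Fin F.J → ℝ := fun j => ∑ n with n ∈ F.scen j, z'.1 n with hOdef'
  have hOO : ∀ j, ∑ n with n ∈ F.scen j, (α * z.1 n + β * z'.1 n) = α * O j + β * O' j :=
    fun j => by rw [Finset.sum_add_distrib, ← Finset.mul_sum, ← Finset.mul_sum]
  have hO0 : ∀ j, 0 ≤ O j := fun j => Finset.sum_nonneg fun n _ => (hz.pos n).le
  have hO0' : ∀ j, 0 ≤ O' j := fun j => Finset.sum_nonneg fun n _ => (hz'.pos n).le
  have hsm : ∀ n, (α * z.1 n + β * z'.1 n) • ((α * z.1 n + β * z'.1 n)⁻¹ •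
      ((α * z.1 n) • z.2.1 n + (β * z'.1 n) • z'.2.1 n)) =
      (α * z.1 n) • z.2.1 n + (β * z'.1 n) • z'.2.1 n := fun n =>
    smul_inv_smul₀ (hpos n).ne' _
  refine ⟨(α • z.1 + β • z'.1,
    fun n => (α * z.1 n + β * z'.1 n)⁻¹ • ((α * z.1 n) • z.2.1 n + (β * z'.1 n) • z'.2.1 n),
    fun j => (α * O j + β * O' j)⁻¹ • ((α * O j) • z.2.2 j + (β * O' j) • z'.2.2 j)),
    ⟨⟨F.W_convex hz.1.1 hz'.1.1 hα hβ hαβ, fun n => ?_, fun j => ?_⟩, fun j => ?_, fun j i => ?_⟩,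
    ?_⟩
  · exact convex_smul_mem (F.D_convex n) (hz.1.2.1 n) (hz'.1.2.1 n)
      (mul_nonneg hα (hz.pos n).le) (mul_nonneg hβ (hz'.pos n).le) (hpos n)
  · exact convex_smul_mem (F.U_convex j) (hz.1.2.2 j) (hz'.1.2.2 j)
      (mul_nonneg hα (hO0 j)) (mul_nonneg hβ (hO0' j)) (by rw [← hOO]; exact hO j)
  · have h := hO j
    rw [hOO] at h
    simp only [Pi.add_apply, Pi.smul_apply, smul_eq_mul, hsm, hOO, Prod.smul_fst, Prod.fst_add]
    rw [smul_inv_smul₀ h.ne', Finset.sum_add_distrib]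
    simp only [mul_smul, ← Finset.smul_sum]
    rw [hz.2.1 j, hz'.2.1 j]
  · have h := hO j
    rw [hOO] at h
    simp only [Pi.add_apply, Pi.smul_apply, smul_eq_mul, hOO, Prod.smul_snd, Prod.snd_add]
    rw [mul_inv_cancel_left₀ h.ne']
    have h1 := mul_le_mul_of_nonneg_left (hz.2.2 j i) hα
    have h2 := mul_le_mul_of_nonneg_left (hz'.2.2 j i) hβ
    calc _ ≤ ∑ n with n ∈ F.scen j, (α * (z.1 n * F.g j n (z.2.1 n) i) +
          β * (z'.1 n * F.g j n (z'.2.1 n) i)) := by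
          refine Finset.sum_le_sum fun n hn => ?_
          have hp := hpos n
          have hg := (F.g_convex j n (Finset.mem_filter.mp hn).2 i).2 (Set.mem_univ (z.2.1 n))
            (Set.mem_univ (z'.2.1 n))
            (mul_nonneg (inv_nonneg.mpr hp.le) (mul_nonneg hα (hz.pos n).le))
            (mul_nonneg (inv_nonneg.mpr hp.le) (mul_nonneg hβ (hz'.pos n).le))
            (by rw [← mul_add, inv_mul_cancel₀ hp.ne'])
          rw [smul_add, smul_smul, smul_smul]
          refine (mul_le_mul_of_nonneg_left hg hp.le).trans (le_of_eq ?_)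
          simp only [smul_eq_mul]
          field_simp
      _ ≤ _ := by
          rw [Finset.sum_add_distrib, ← Finset.mul_sum, ← Finset.mul_sum]
          exact (add_le_add h1 h2).trans_eq (by simp only [hOdef, hOdef']; ring)
  · simp only [Pi.add_apply, Pi.smul_apply, smul_eq_mul, hsm]
    rw [Finset.sum_add_distrib]
    simp only [mul_smul, ← Finset.smul_sum]

end LiftedFormat
-- Conditioning on scenarios, and finitely supported laws
section Scenario

variable {X E : Type*} [MeasurableSpace X] [NormedAddCommGroup E] [NormedSpace ℝ E] {N : ℕ}

theorem measurableSet_snd_mem (B : Set (Fin N)) :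
    MeasurableSet {x : X × Fin N | x.2 ∈ B} := measurable_snd (MeasurableSet.of_discrete)

theorem measurableSet_snd_eq (n : Fin N) :
    MeasurableSet {x : X × Fin N | x.2 = n} := measurableSet_snd_mem {n}

open Classical in
theorem setIntegral_snd_mem (P : Measure (X × Fin N)) (B : Set (Fin N)) {f : X × Fin N → E}
    (hf : ∀ n ∈ B, IntegrableOn f {x | x.2 = n} P) :
    ∫ x in {x | x.2 ∈ B}, f x ∂P = ∑ n with n ∈ B, ∫ x in {x | x.2 = n}, f x ∂P := by
  have h : {x : X × Fin N | x.2 ∈ B} = ⋃ n ∈ Finset.univ.filter (· ∈ B), {x | x.2 = n} := by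
    ext x; simp
  rw [h, integral_biUnion_finset]
  · exact fun n _ => measurableSet_snd_eq n
  · intro n _ m _ hnm
    rw [Function.onFun, Set.disjoint_left]
    rintro x rfl h
    exact hnm h
  · exact fun n hn => hf n (Finset.mem_filter.mp hn).2

open Classical in
theorem measureReal_snd_mem (P : Measure (X × Fin N)) [IsFiniteMeasure P] (B : Set (Fin N)) :
    P.real {x | x.2 ∈ B} = ∑ n with n ∈ B, P.real {x | x.2 = n} := by
  have := setIntegral_snd_mem P B (f := fun _ => (1 : ℝ)) fun n _ => integrableOn_const
  simpa using this

theorem integral_eq_sum_setIntegral_snd (P : Measure (X × Fin N)) {f : X × Fin N → E}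
    (hf : ∀ n, IntegrableOn f {x | x.2 = n} P) :
    ∫ x, f x ∂P = ∑ n, ∫ x in {x | x.2 = n}, f x ∂P := by
  classical
  simpa using setIntegral_snd_mem P Set.univ fun n _ => hf n

theorem integral_cond {Ω : Type*} [MeasurableSpace Ω] (P : Measure Ω) (s : Set Ω) (f : Ω → E) :
    ∫ x, f x ∂P[|s] = (P.real s)⁻¹ • ∫ x in s, f x ∂P := by
  rw [ProbabilityTheory.cond, integral_smul_measure, ENNReal.toReal_inv, Measure.real]

open Classical in
theorem integral_cond_snd_mem (P : Measure (X × Fin N)) [IsFiniteMeasure P] (B : Set (Fin N))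
    {f : X × Fin N → E} (hf : ∀ n ∈ B, IntegrableOn f {x | x.2 = n} P) :
    ∫ x, f x ∂P[|{x | x.2 ∈ B}] = (∑ n with n ∈ B, P.real {x | x.2 = n})⁻¹ •
      ∑ n with n ∈ B, ∫ x in {x | x.2 = n}, f x ∂P := by
  rw [integral_cond, measureReal_snd_mem, setIntegral_snd_mem P B hf]

omit [NormedSpace ℝ E] in
/-- A continuous function of a random element of a compact set is integrable. -/
theorem integrable_comp_of_ae_mem_isCompact {Ω Y : Type*} [MeasurableSpace Ω] [TopologicalSpace Y]
    [MeasurableSpace Y] [OpensMeasurableSpace Y] [SecondCountableTopology E] {μ : Measure Ω}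
    [IsFiniteMeasure μ] {K : Set Y} (hK : IsCompact K) {X : Ω → Y} (hX : Measurable X)
    (hXK : ∀ᵐ x ∂μ, X x ∈ K) {h : Y → E} (hh : Continuous h) :
    Integrable (fun x => h (X x)) μ := by
  borelize E
  obtain ⟨C, hC⟩ := hK.exists_bound_of_continuousOn hh.continuousOn
  exact Integrable.of_bound (hh.measurable.comp hX).aestronglyMeasurable C
    (hXK.mono fun x hx => hC _ hx)

/-- The law under which the scenario is `n` with probability `ω n`, and then the parameter is
`m n`. -/
def scenarioLaw (ω : Fin N → ℝ) (m : Fin N → X) : Measure (X × Fin N) :=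
  ∑ n, ENNReal.ofReal (ω n) • Measure.dirac (m n, n)

theorem isProbabilityMeasure_scenarioLaw {ω : Fin N → ℝ} (m : Fin N → X) (hω : ∀ n, 0 ≤ ω n)
    (hω1 : ∑ n, ω n = 1) : IsProbabilityMeasure (scenarioLaw ω m) := by
  constructor
  simp [scenarioLaw, ← ENNReal.ofReal_sum_of_nonneg fun n _ => hω n, hω1]

variable [MeasurableSingletonClass X]

theorem scenarioLaw_restrict (ω : Fin N → ℝ) (m : Fin N → X) (n : Fin N) :
    (scenarioLaw ω m).restrict {x | x.2 = n} =
      ENNReal.ofReal (ω n) • Measure.dirac (m n, n) := by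
  classical
  rw [scenarioLaw, ← Measure.restrictₗ_apply, map_sum, Finset.sum_eq_single n]
  · rw [Measure.restrictₗ_apply, Measure.restrict_smul, restrict_dirac,
      if_pos (show (m n, n) ∈ {x : X × Fin N | x.2 = n} from rfl)]
  · intro k _ hk
    rw [Measure.restrictₗ_apply, Measure.restrict_smul, restrict_dirac,
      if_neg (show (m k, k) ∉ {x : X × Fin N | x.2 = n} from hk), smul_zero]
  · simp

theorem scenarioLaw_setIntegral [CompleteSpace E] {ω : Fin N → ℝ} (m : Fin N → X) {n : Fin N}
    (hω : 0 ≤ ω n) (f : X × Fin N → E) :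
    ∫ x in {x | x.2 = n}, f x ∂scenarioLaw ω m = ω n • f (m n, n) := by
  rw [scenarioLaw_restrict, integral_smul_measure, integral_dirac, ENNReal.toReal_ofReal hω]

omit [NormedSpace ℝ E] in
theorem scenarioLaw_integrableOn (ω : Fin N → ℝ) (m : Fin N → X) (n : Fin N)
    (f : X × Fin N → E) : IntegrableOn f {x | x.2 = n} (scenarioLaw ω m) := by
  rw [IntegrableOn, scenarioLaw_restrict]
  exact (integrable_dirac (by simp)).smul_measure ENNReal.ofReal_ne_top

theorem scenarioLaw_real {ω : Fin N → ℝ} (m : Fin N → X) {n : Fin N} (hω : 0 ≤ ω n) :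
    (scenarioLaw ω m).real {x | x.2 = n} = ω n := by
  simpa using scenarioLaw_setIntegral m hω fun _ => (1 : ℝ)

theorem scenarioLaw_cond {ω : Fin N → ℝ} (m : Fin N → X) {n : Fin N} (hω : 0 < ω n) :
    (scenarioLaw ω m)[|{x | x.2 = n}] = Measure.dirac (m n, n) := by
  have h : scenarioLaw ω m {x | x.2 = n} = ENNReal.ofReal (ω n) := by
    rw [← Measure.restrict_apply_univ, scenarioLaw_restrict]; simp
  rw [ProbabilityTheory.cond, scenarioLaw_restrict, h, smul_smul, ENNReal.inv_mul_cancel, one_smul]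
  · simpa using hω
  · exact ENNReal.ofReal_ne_top

end Scenario

/-! ### Means of the laws in an ambiguity set -/

namespace LiftedFormat

variable {S : Type u} {A : Type v} [Fintype S] [Fintype A]

theorem ae_mem_D_cond {F : LiftedFormat S A} {P} (hP : P ∈ F.ambiguity) (n : Fin F.N) :
    ∀ᵐ x ∂P[|{x | x.2 = n}], x.1 ∈ F.D n := by
  have := hP.1
  obtain ⟨-, ω, -, μν, -, -, -, hD, -⟩ := hP
  -- Conditioning on a null event gives the zero measure, which cannot assign probability one to the
  -- support.
  have hp : IsProbabilityMeasure P[|{x | x.2 = n}] := by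
    refine cond_isProbabilityMeasure fun h => ?_
    have h1 := hD n
    rw [cond_eq_zero_of_meas_eq_zero h] at h1
    simp at h1
  have hm : MeasurableSet {x : Param S A × Fin F.N | x.1 ∈ F.D n} :=
    measurable_fst (F.D_compact n).measurableSet
  exact (prob_compl_eq_zero_iff hm).mpr (hD n)

theorem measureReal_pos {F : LiftedFormat S A} {P} (hP : P ∈ F.ambiguity) (n : Fin F.N) :
    0 < P.real {x | x.2 = n} := by
  obtain ⟨-, ω, hω, μν, -, -, -, -, h⟩ := hP
  rw [h n]
  exact (F.W_subset hω).1 n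

theorem measure_ne_zero {F : LiftedFormat S A} {P} (hP : P ∈ F.ambiguity) (n : Fin F.N) :
    P {x | x.2 = n} ≠ 0 := fun h => by
  have := measureReal_pos hP n
  simp [Measure.real, h] at this

theorem ae_mem_D {F : LiftedFormat S A} {P} (hP : P ∈ F.ambiguity) :
    ∀ᵐ x ∂P, x.1 ∈ F.D x.2 := by
  have := hP.1
  have h : ∀ n, ∀ᵐ x ∂P, x.2 = n → x.1 ∈ F.D n := fun n => by
    refine (ae_restrict_iff' (measurableSet_snd_eq n)).mp ?_
    have h1 := ae_mem_D_cond hP n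
    rw [ProbabilityTheory.cond, Measure.ae_ennreal_smul_measure_iff
      (ENNReal.inv_ne_zero.mpr (measure_ne_top _ _))] at h1
    exact h1
  filter_upwards [ae_all_iff.mpr h] with x hx using hx _ rfl

/-- A compact set that contains the parameters almost surely. -/
theorem exists_isCompact_ae_mem (F : LiftedFormat S A) :
    ∃ K : Set (Param S A), IsCompact K ∧ ∀ P ∈ F.ambiguity, ∀ᵐ x ∂P, x.1 ∈ K :=
  ⟨⋃ n, F.D n, isCompact_iUnion F.D_compact, fun _ hP =>
    (ae_mem_D hP).mono fun _ hx => Set.mem_iUnion.mpr ⟨_, hx⟩⟩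

theorem integrable_comp_fst {F : LiftedFormat S A} {P} (hP : P ∈ F.ambiguity) {E : Type*}
    [NormedAddCommGroup E] [NormedSpace ℝ E] [SecondCountableTopology E]
    {h : Param S A → E} (hh : Continuous h) : Integrable (fun x => h x.1) P := by
  have := hP.1
  obtain ⟨K, hK, hKP⟩ := F.exists_isCompact_ae_mem
  exact integrable_comp_of_ae_mem_isCompact hK measurable_fst (hKP P hP) hh

theorem setIntegral_eq_smul_integral_cond {Ω E : Type*} [MeasurableSpace Ω]
    [NormedAddCommGroup E] [NormedSpace ℝ E] (P : Measure Ω) {s : Set Ω} (hs : P.real s ≠ 0)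
    (f : Ω → E) : ∫ x in s, f x ∂P = P.real s • ∫ x, f x ∂P[|s] := by
  rw [integral_cond, smul_inv_smul₀ hs]

/-- The scenario-wise means of a law of the ambiguity set satisfy its constraints, by Jensen's
inequality. -/
theorem integral_mem_meanSet {F : LiftedFormat S A} {P} (hP : P ∈ F.ambiguity) :
    ∫ x, x.1 ∂P ∈ F.meanSet := by
  classical
  have hpr := hP.1
  have hfst : Integrable (fun x : Param S A × Fin F.N => x.1) P :=
    integrable_comp_fst hP continuous_id
  have hprn : ∀ n, IsProbabilityMeasure P[|{x | x.2 = n}] := fun n =>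
    cond_isProbabilityMeasure (measure_ne_zero hP n)
  have hD := ae_mem_D_cond hP
  have hpos := measureReal_pos hP
  obtain ⟨-, ω, hω, μν, hU, h1, h2, -, h4⟩ := hP
  have hO : ∀ j, 0 < ∑ n with n ∈ F.scen j, ω n := fun j => by
    obtain ⟨n, hn⟩ := F.scen_nonempty j
    exact Finset.sum_pos (fun n _ => (F.W_subset hω).1 n) ⟨n, by simpa using hn⟩
  have hint : ∀ (n : Fin F.N) {E : Type} [NormedAddCommGroup E] [NormedSpace ℝ E]
      [SecondCountableTopology E] {h : Param S A → E}, Continuous h →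
      Integrable (fun x => h x.1) P[|{x | x.2 = n}] := fun n _ _ _ _ _ hh =>
    integrable_comp_of_ae_mem_isCompact (F.D_compact n) measurable_fst (hD n) hh
  have hset : ∀ n, ∫ x in {x | x.2 = n}, x.1 ∂P = ω n • ∫ x, x.1 ∂P[|{x | x.2 = n}] :=
    fun n => by rw [setIntegral_eq_smul_integral_cond P (hpos n).ne', h4]
  have hgeq : ∀ j i, ∀ n, ∀ᵐ x ∂P[|{x | x.2 = n}], F.g j x.2 x.1 i = F.g j n x.1 i := by
    intro j i n
    filter_upwards [ae_cond_mem (measurableSet_snd_eq n)] with x hx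
    rw [show x.2 = n from hx]
  -- Integrability lets the conditional moment split into scenarios; a non-integrable piece would
  -- have the default integral zero.
  have hgint : ∀ j i, ∀ n ∈ F.scen j,
      IntegrableOn (fun x => F.g j x.2 x.1 i) {x | x.2 = n} P := by
    intro j i n hn
    have h5 := (hint n (F.continuous_g hn i)).congr
      ((hgeq j i n).mono fun x hx => hx.symm)
    rw [ProbabilityTheory.cond] at h5
    exact (integrable_smul_measure (ENNReal.inv_ne_zero.mpr (measure_ne_top _ _))
      (ENNReal.inv_ne_top.mpr (fun h => (hpos n).ne' (by simp [Measure.real, h])))).mp h5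
  refine ⟨(ω, fun n => ∫ x, x.1 ∂P[|{x | x.2 = n}], μν), ⟨⟨hω, fun n => ?_, hU⟩, fun j => ?_,
    fun j i => ?_⟩, ?_⟩
  · exact (F.D_convex n).integral_mem (F.D_compact n).isClosed (hD n)
      (integrable_comp_of_ae_mem_isCompact (F.D_compact n) measurable_fst (hD n) continuous_id)
  · have h5 := h1 j
    rw [integral_cond_snd_mem P _ fun n _ => hfst.integrableOn] at h5
    simp only [h4, hset] at h5
    rw [← h5, smul_inv_smul₀ (hO j).ne']
  · have h5 := h2 j i
    rw [integral_cond_snd_mem P _ (hgint j i), smul_eq_mul] at h5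
    simp only [h4] at h5
    rw [inv_mul_le_iff₀ (hO j)] at h5
    refine le_trans (Finset.sum_le_sum fun n hn => ?_) h5
    have hn' := (Finset.mem_filter.mp hn).2
    rw [setIntegral_eq_smul_integral_cond P (hpos n).ne', h4, smul_eq_mul,
      integral_congr_ae (hgeq j i n)]
    refine mul_le_mul_of_nonneg_left ?_ ((F.W_subset hω).1 n).le
    exact (F.g_convex j n hn' i).map_integral_le (F.continuous_g hn' i).continuousOn isClosed_univ
      (by simp) (integrable_comp_of_ae_mem_isCompact (F.D_compact n) measurable_fst (hD n)
        continuous_id) (hint n (F.continuous_g hn' i))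
  · simp only
    rw [integral_eq_sum_setIntegral_snd P fun n => hfst.integrableOn]
    exact Finset.sum_congr rfl fun n _ => (hset n).symm

theorem meanSet_nonempty {F : LiftedFormat S A} (hF : F.ambiguity.Nonempty) :
    F.meanSet.Nonempty :=
  let ⟨_, hP⟩ := hF
  ⟨_, integral_mem_meanSet hP⟩

/-- Point masses at the scenario-wise means turn the constraints of `IsScenarioMean` back into those
of the ambiguity set. Together with `integral_mem_meanSet`, this identifies `meanSet` as exactly the
set of attainable means. -/
theorem exists_integral_eq_of_mem_meanSet {F : LiftedFormat S A} {y : Param S A}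
    (hy : y ∈ F.meanSet) : ∃ P ∈ F.ambiguity, ∫ x, x.1 ∂P = y := by
  classical
  obtain ⟨⟨ω, m, μν⟩, hz, rfl⟩ := hy
  have hω : ∀ n, 0 < ω n := hz.pos
  obtain ⟨⟨hW, hD, hU⟩, h1, h2⟩ := hz
  have hpr := isProbabilityMeasure_scenarioLaw m (fun n => (hω n).le) (F.W_subset hW).2
  have hO : ∀ j, 0 < ∑ n with n ∈ F.scen j, ω n := fun j => by
    obtain ⟨n, hn⟩ := F.scen_nonempty j
    exact Finset.sum_pos (fun n _ => hω n) ⟨n, by simpa using hn⟩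
  refine ⟨scenarioLaw ω m, ⟨hpr, ω, hW, μν, hU, fun j => ?_, fun j i => ?_, fun n => ?_,
    fun n => scenarioLaw_real m (hω n).le⟩, ?_⟩
  · rw [integral_cond_snd_mem _ _ fun n _ => scenarioLaw_integrableOn ω m n _]
    simp only [scenarioLaw_real m (hω _).le, scenarioLaw_setIntegral m (hω _).le]
    rw [h1 j, inv_smul_smul₀ (hO j).ne']
  · rw [integral_cond_snd_mem _ _ fun n _ => scenarioLaw_integrableOn ω m n _]
    simp only [scenarioLaw_real m (hω _).le, scenarioLaw_setIntegral m (hω _).le, smul_eq_mul]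
    rw [inv_mul_le_iff₀ (hO j)]
    exact h2 j i
  · rw [scenarioLaw_cond m (hω n)]
    simp [hD n]
  · rw [integral_eq_sum_setIntegral_snd _ fun n => scenarioLaw_integrableOn ω m n _]
    simp only [scenarioLaw_setIntegral m (hω _).le]

end LiftedFormat
-- Policy evaluation by backward induction
namespace DRMDP

variable {S : Type u} {A : S → Type v} [Fintype S] [∀ s, Fintype (A s)]

/-- The probability that `π` takes the action `a` at the stage `k` in the state `s` after the
history `h`; it is zero from the last stage on. -/
def act (M : DRMDP S A) (π : M.Policy) (k : ℕ) (h : Fin k → Σ s, A s) (s : S) (a : A s) : ℝ :=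
  if hk : k < M.H then (π ⟨k, hk⟩ h s : A s → ℝ) a else 0

theorem act_of_lt (M : DRMDP S A) (π : M.Policy) {k : ℕ} (hk : k < M.H) (h : Fin k → Σ s, A s)
    (s : S) (a : A s) : M.act π k h s a = (π ⟨k, hk⟩ h s : A s → ℝ) a := dif_pos hk

open Classical in
/-- The probability that the first `k` state-action pairs are `h` and that the next state
is `s`. -/
def prefixProb (M : DRMDP S A) (π : M.Policy) (p : (s : S) → A s → S → ℝ) :
    (k : ℕ) → (Fin k → Σ s, A s) → S → ℝ
  | 0, _, s => if s = M.s₁ then 1 else 0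
  | k + 1, h, s' => prefixProb M π p k (Fin.init h) (h (Fin.last k)).1 *
      (M.act π k (Fin.init h) (h (Fin.last k)).1 (h (Fin.last k)).2 *
        p (h (Fin.last k)).1 (h (Fin.last k)).2 s')

/-- The right-hand side of the policy evaluation equations at the stage `k`. -/
def backup (M : DRMDP S A) (π : M.Policy) (θ : (s : S) → Param S (A s)) (k : ℕ)
    (g : (Fin (k + 1) → Σ s, A s) → S → ℝ) (h : Fin k → Σ s, A s) (s : S) : ℝ :=
  ∑ a, M.act π k h s a * ((θ s).2 a + M.γ * ∑ s' with (M.stage s' : ℕ) = M.stage s + 1,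
    (θ s).1 a s' * g (Fin.snoc (α := fun _ => Σ s, A s) h ⟨s, a⟩) s')

/-- The expected discounted reward to go under `π` and the parameters `θ`, with `j` decisions to go
after `k` decisions. -/
def value (M : DRMDP S A) (π : M.Policy) (θ : (s : S) → Param S (A s)) :
    ℕ → (k : ℕ) → (Fin k → Σ s, A s) → S → ℝ
  | 0 => fun _ _ _ => 0
  | j + 1 => fun k => M.backup π θ k (value M π θ j (k + 1))

/-- Before the last stage, the transition probabilities are those of a layered MDP. -/
def Admissible (M : DRMDP S A) (θ : (s : S) → Param S (A s)) : Prop :=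
  ∀ s, (M.stage s : ℕ) < M.H → ∀ a : A s, (∀ s', 0 ≤ (θ s).1 a s') ∧ ∑ s', (θ s).1 a s' = 1 ∧
    ∀ s', (M.stage s' : ℕ) ≠ M.stage s + 1 → (θ s).1 a s' = 0

theorem stateAt_of_lt (M : DRMDP S A) (τ : M.Traj) {k : ℕ} (hk : k < M.H) :
    M.stateAt τ ⟨k, hk.trans (Nat.lt_succ_self _)⟩ = (τ.1 ⟨k, hk⟩).1 := by
  exact Fin.snoc_castSucc (α := fun _ => S) τ.2 (fun t => (τ.1 t).1) ⟨k, hk⟩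

open Classical in
theorem prefixProb_eq (M : DRMDP S A) (π : M.Policy) (p : (s : S) → A s → S → ℝ) (τ : M.Traj)
    (k : ℕ) (hk : k ≤ M.H) :
    M.prefixProb π p k (fun i => τ.1 ⟨i, i.2.trans_le hk⟩) (M.stateAt τ ⟨k, Nat.lt_succ_of_le hk⟩) =
      (if M.stateAt τ 0 = M.s₁ then 1 else 0) *
        ∏ t : Fin k, (π ⟨t, t.2.trans_le hk⟩ (M.past τ ⟨t, t.2.trans_le hk⟩)
          (τ.1 ⟨t, t.2.trans_le hk⟩).1 : A (τ.1 ⟨t, t.2.trans_le hk⟩).1 → ℝ)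
            (τ.1 ⟨t, t.2.trans_le hk⟩).2 *
          p (τ.1 ⟨t, t.2.trans_le hk⟩).1 (τ.1 ⟨t, t.2.trans_le hk⟩).2
            (M.stateAt τ ⟨t + 1, Nat.succ_lt_succ (t.2.trans_le hk)⟩) := by
  induction k with
  | zero =>
    rw [prefixProb, Fin.prod_univ_zero, mul_one]
    rfl
  | succ k ih =>
    have hk' : k < M.H := hk
    have h := ih hk'.le
    rw [M.stateAt_of_lt τ hk'] at h
    rw [prefixProb, Fin.prod_univ_castSucc, M.act_of_lt π hk']
    exact (congrArg (· * _) h).trans (mul_assoc _ _ _)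

theorem trajProb_eq_prefixProb (M : DRMDP S A) (π : M.Policy) (p : (s : S) → A s → S → ℝ)
    (τ : M.Traj) : M.trajProb π p τ = M.prefixProb π p M.H τ.1 τ.2 := by
  have h := M.prefixProb_eq π p τ M.H le_rfl
  have h2 : M.stateAt τ ⟨M.H, Nat.lt_succ_self _⟩ = τ.2 :=
    Fin.snoc_last (α := fun _ => S) τ.2 (fun t => (τ.1 t).1)
  rw [h2] at h
  exact h.symm

/-- Each transition of positive probability climbs exactly one stage, starting from stage zero.
Admissibility is only available before the last stage, hence the bound on `k`. -/
theorem stage_eq_of_prefixProb_ne_zero (M : DRMDP S A) (π : M.Policy)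
    {θ : (s : S) → Param S (A s)} (hθ : M.Admissible θ) :
    ∀ (k : ℕ) (h : Fin k → Σ s, A s) (s : S), k ≤ M.H →
      M.prefixProb π (fun s => (θ s).1) k h s ≠ 0 → (M.stage s : ℕ) = k
  | 0, _, s, _, hne => by
    have : s = M.s₁ := by
      by_contra hs
      simp [prefixProb, hs] at hne
    rw [(M.stage_eq_zero_iff s).mpr this]
    rfl
  | k + 1, h, s, hk, hne => by
    rw [prefixProb] at hne
    have h1 := M.stage_eq_of_prefixProb_ne_zero π hθ k _ _ (Nat.le_of_succ_le hk)
      (left_ne_zero_of_mul hne)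
    by_contra hs
    exact right_ne_zero_of_mul (right_ne_zero_of_mul hne)
      ((hθ _ (by omega) _).2.2 s (by rw [h1]; exact hs))

/-- The expected reward before the stage `n` plus the discounted expectation of `g` there. -/
def prefixSum (M : DRMDP S A) (π : M.Policy) (θ : (s : S) → Param S (A s)) (n : ℕ)
    (g : (Fin n → Σ s, A s) → S → ℝ) : ℝ :=
  ∑ h : Fin n → Σ s, A s, ∑ s, M.prefixProb π (fun s => (θ s).1) n h s *
    (∑ t : Fin n, M.γ ^ (t : ℕ) * (θ (h t).1).2 (h t).2 + M.γ ^ n * g h s)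

theorem sum_snoc {X β : Type*} [Fintype X] [AddCommMonoid β] (n : ℕ) (F : (Fin (n + 1) → X) → β) :
    ∑ h, F h = ∑ h : Fin n → X, ∑ x, F (Fin.snoc (α := fun _ => X) h x) := by
  rw [← (Fin.snocEquiv fun _ => X).sum_comp F, Fintype.sum_prod_type, Finset.sum_comm]
  rfl

theorem prefixProb_snoc (M : DRMDP S A) (π : M.Policy) (p : (s : S) → A s → S → ℝ) (n : ℕ)
    (h : Fin n → Σ s, A s) (x : Σ s, A s) (s' : S) :
    M.prefixProb π p (n + 1) (Fin.snoc (α := fun _ => Σ s, A s) h x) s' =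
      M.prefixProb π p n h x.1 * (M.act π n h x.1 x.2 * p x.1 x.2 s') := by
  -- The action type depends on the last state, so rewriting inside `Fin.snoc` is awkward. A
  -- variable history with prescribed initial part and last pair allows substitution instead.
  suffices ∀ h' : Fin (n + 1) → Σ s, A s, Fin.init h' = h → h' (Fin.last n) = x →
      M.prefixProb π p (n + 1) h' s' =
        M.prefixProb π p n h x.1 * (M.act π n h x.1 x.2 * p x.1 x.2 s') from
    this _ (Fin.init_snoc (α := fun _ => Σ s, A s) x h) (Fin.snoc_last (α := fun _ => Σ s, A s) x h)
  rintro h' rfl rfl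
  rfl

theorem sum_pow_mul_snoc {X : Type*} (n : ℕ) (c : ℝ) (f : X → ℝ) (h : Fin n → X) (x : X) :
    ∑ t : Fin (n + 1), c ^ (t : ℕ) * f (Fin.snoc (α := fun _ => X) h x t) =
      ∑ t : Fin n, c ^ (t : ℕ) * f (h t) + c ^ n * f x := by
  simp [Fin.sum_univ_castSucc]

theorem sum_act (M : DRMDP S A) (π : M.Policy) {k : ℕ} (hk : k < M.H) (h : Fin k → Σ s, A s)
    (s : S) : ∑ a, M.act π k h s a = 1 := by
  simp only [M.act_of_lt π hk]
  exact (π ⟨k, hk⟩ h s).2.2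

theorem act_nonneg (M : DRMDP S A) (π : M.Policy) (k : ℕ) (h : Fin k → Σ s, A s)
    (s : S) (a : A s) : 0 ≤ M.act π k h s a := by
  rw [act]
  split_ifs with hk
  · exact (π ⟨k, hk⟩ h s).2.1 a
  · exact le_rfl

theorem Admissible.sum_filter {M : DRMDP S A} {θ : (s : S) → Param S (A s)}
    (hθ : M.Admissible θ) {s : S} (hs : (M.stage s : ℕ) < M.H) (a : A s) (f : S → ℝ) :
    ∑ s' with (M.stage s' : ℕ) = M.stage s + 1, (θ s).1 a s' * f s' =
      ∑ s', (θ s).1 a s' * f s' := by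
  refine Finset.sum_filter_of_ne fun s' _ h => ?_
  by_contra hne
  exact left_ne_zero_of_mul h ((hθ s hs a).2.2 s' hne)

/-- Summing out the last action and the state after it leaves the earlier rewards unchanged, since
both distributions have total mass one. What remains is the backup of `g`. -/
theorem prefixSum_succ (M : DRMDP S A) (π : M.Policy) {θ : (s : S) → Param S (A s)}
    (hθ : M.Admissible θ) {n : ℕ} (hn : n < M.H) (g : (Fin (n + 1) → Σ s, A s) → S → ℝ) :
    M.prefixSum π θ (n + 1) g = M.prefixSum π θ n (M.backup π θ n g) := by
  rw [prefixSum, prefixSum, sum_snoc]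
  refine Finset.sum_congr rfl fun h _ => ?_
  rw [Fintype.sum_sigma]
  refine Finset.sum_congr rfl fun s _ => ?_
  simp only [prefixProb_snoc, sum_pow_mul_snoc n M.γ fun x : Σ s, A s => (θ x.1).2 x.2]
  -- Histories of probability zero contribute nothing to either side. Any other history ends on
  -- stage `n`, where the transition probabilities are admissible.
  by_cases hpr : M.prefixProb π (fun s => (θ s).1) n h s = 0
  · simp [hpr]
  have hs := M.stage_eq_of_prefixProb_ne_zero π hθ n h s hn.le hpr
  have hsH : (M.stage s : ℕ) < M.H := by omega
  set R := ∑ t : Fin n, M.γ ^ (t : ℕ) * (θ (h t).1).2 (h t).2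
  have hR : R + M.γ ^ n * M.backup π θ n g h s =
      ∑ a, M.act π n h s a * R + M.γ ^ n * M.backup π θ n g h s := by
    rw [← Finset.sum_mul, M.sum_act π hn, one_mul]
  rw [hR, backup, Finset.mul_sum, ← Finset.sum_add_distrib, Finset.mul_sum]
  refine Finset.sum_congr rfl fun a _ => ?_
  rw [hθ.sum_filter hsH]
  set G : S → ℝ := g (Fin.snoc (α := fun _ => Σ s, A s) h ⟨s, a⟩)
  set p := (θ s).1 a
  set Pr := M.prefixProb π (fun s => (θ s).1) n h s
  set c := M.act π n h s a
  have hp : ∑ s', p s' = 1 := (hθ s hsH a).2.1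
  calc _ = ∑ s', (Pr * c * (R + M.γ ^ n * (θ s).2 a) * p s' +
        Pr * c * M.γ ^ (n + 1) * (p s' * G s')) := Finset.sum_congr rfl fun s' _ => by ring
    _ = Pr * c * (R + M.γ ^ n * (θ s).2 a) + Pr * c * M.γ ^ (n + 1) * ∑ s', p s' * G s' := by
      rw [Finset.sum_add_distrib, ← Finset.mul_sum, ← Finset.mul_sum, hp, mul_one]
    _ = _ := by ring

theorem totalReward_eq_prefixSum (M : DRMDP S A) (π : M.Policy) (θ : (s : S) → Param S (A s)) :
    M.totalReward π (fun s => (θ s).1) (fun s => (θ s).2) =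
      M.prefixSum π θ M.H (fun _ _ => 0) := by
  rw [totalReward, prefixSum, Fintype.sum_prod_type]
  refine Finset.sum_congr rfl fun h _ => Finset.sum_congr rfl fun s _ => ?_
  rw [trajProb_eq_prefixProb, mul_zero, add_zero]

theorem prefixSum_zero (M : DRMDP S A) (π : M.Policy) (θ : (s : S) → Param S (A s))
    (g : (Fin 0 → Σ s, A s) → S → ℝ) : M.prefixSum π θ 0 g = g Fin.elim0 M.s₁ := by
  classical
  simp only [prefixSum, prefixProb, Fintype.sum_unique, Finset.univ_eq_empty, Finset.sum_empty,
    pow_zero, one_mul, zero_add, ite_mul, zero_mul, Finset.sum_ite_eq', Finset.mem_univ, if_true]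
  exact congrArg (g · M.s₁) (Subsingleton.elim _ _)

/-- The split point between realized rewards and reward to go moves back one stage at a time without
changing the total. -/
theorem prefixSum_value (M : DRMDP S A) (π : M.Policy) {θ : (s : S) → Param S (A s)}
    (hθ : M.Admissible θ) : ∀ (j k : ℕ), k + j = M.H →
      M.prefixSum π θ M.H (fun _ _ => 0) = M.prefixSum π θ k (M.value π θ j k)
  | 0, k, h => by
    obtain rfl : k = M.H := h
    rfl
  | j + 1, k, h => by
    rw [M.prefixSum_value π hθ j (k + 1) (by omega), M.prefixSum_succ π hθ (by omega)]
    rfl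

/-- Policy evaluation by backward induction. -/
theorem totalReward_eq_value (M : DRMDP S A) (π : M.Policy) {θ : (s : S) → Param S (A s)}
    (hθ : M.Admissible θ) : M.totalReward π (fun s => (θ s).1) (fun s => (θ s).2) =
      M.value π θ M.H 0 Fin.elim0 M.s₁ := by
  rw [totalReward_eq_prefixSum, M.prefixSum_value π hθ M.H 0 (zero_add _), prefixSum_zero]

end DRMDP
-- Product laws act through their means
/-- Under a product measure, one coordinate is independent of a function of the others. -/
theorem integral_mul_pi_of_forall_ne {ι : Type*} [Fintype ι] {X : ι → Type*}
    [∀ i, MeasurableSpace (X i)] (μ : (i : ι) → Measure (X i)) [∀ i, IsProbabilityMeasure (μ i)]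
    (i : ι) {f : X i → ℝ} {G : ((i : ι) → X i) → ℝ} (hf : Measurable f) (hG : Measurable G)
    (hGi : ∀ ξ ξ', (∀ k, k ≠ i → ξ k = ξ' k) → G ξ = G ξ') :
    ∫ ξ, f (ξ i) * G ξ ∂Measure.pi μ = (∫ x, f x ∂μ i) * ∫ ξ, G ξ ∂Measure.pi μ := by
  classical
  have hne : ∀ k, Nonempty (X k) := fun k => nonempty_of_isProbabilityMeasure (μ k)
  let ξ₀ : (i : ι) → X i := fun k => Classical.arbitrary _
  have hind := (iIndepFun_pi (μ := μ) (X := fun _ => id) fun _ => aemeasurable_id).indepFun_finset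
    {i} (Finset.univ.erase i) (by simp) fun k => measurable_pi_apply k
  let φ : ((k : ({i} : Finset ι)) → X k) → ℝ := fun y => f (y ⟨i, Finset.mem_singleton_self i⟩)
  -- `G` ignores the coordinate `i`, so filling it with an arbitrary point `ξ₀ i` expresses `G`
  -- through the remaining coordinates.
  let ψ : ((k : (Finset.univ.erase i : Finset ι)) → X k) → ℝ := fun y =>
    G fun k => if h : k ∈ Finset.univ.erase i then y ⟨k, h⟩ else ξ₀ k
  have hφ : Measurable φ := hf.comp (measurable_pi_apply _)
  have hψ : Measurable ψ := by
    refine hG.comp (measurable_pi_iff.mpr fun k => ?_)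
    by_cases h : k ∈ Finset.univ.erase i
    · simp only [h, dif_pos]
      exact measurable_pi_apply _
    · simp [h]
  have h1 := (hind.comp hφ hψ).integral_fun_mul_eq_mul_integral
    (hφ.comp (by fun_prop)).aestronglyMeasurable (hψ.comp (by fun_prop)).aestronglyMeasurable
  have h2 : ∀ ξ : (i : ι) → X i,
      G (fun k => if k ∈ Finset.univ.erase i then ξ k else ξ₀ k) = G ξ :=
    fun ξ => hGi _ _ fun k hk => by simp [hk]
  have h3 : ∫ ξ, f (ξ i) ∂Measure.pi μ = ∫ x, f x ∂μ i := by
    rw [← (measurePreserving_eval μ i).map_eq, integral_map (measurable_pi_apply i).aemeasurable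
      hf.aestronglyMeasurable]
  simp only [Function.comp_apply, φ, ψ, id, dite_eq_ite, h2, h3] at h1
  exact h1

namespace LiftedFormat

theorem integral_linear {S : Type u} {A : Type v} [Fintype S] [Fintype A] {F : LiftedFormat S A}
    {P} (hP : P ∈ F.ambiguity) {E : Type*} [NormedAddCommGroup E] [NormedSpace ℝ E]
    [CompleteSpace E] (L : Param S A →L[ℝ] E) : ∫ x, L x.1 ∂P = L (∫ x, x.1 ∂P) :=
  L.integral_comp_comm (integrable_comp_fst hP continuous_id)

end LiftedFormat

namespace DRMDP

variable {S : Type u} {A : S → Type v} [Fintype S] [∀ s, Fintype (A s)]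

theorem continuous_value (M : DRMDP S A) (π : M.Policy) : ∀ (j k : ℕ) (h : Fin k → Σ s, A s)
    (s : S), Continuous fun θ : (s : S) → Param S (A s) => M.value π θ j k h s
  | 0, _, _, _ => continuous_const
  | j + 1, k, h, s => by
    have ih := M.continuous_value π j (k + 1)
    simp only [value, backup]
    fun_prop

/-- The reward to go only depends on the parameters of the current and the later stages. -/
theorem value_congr (M : DRMDP S A) (π : M.Policy) {θ θ' : (s : S) → Param S (A s)} :
    ∀ (j k : ℕ) (h : Fin k → Σ s, A s) (s : S), (∀ s, k ≤ M.stage s → θ s = θ' s) →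
      k ≤ M.stage s → M.value π θ j k h s = M.value π θ' j k h s
  | 0, _, _, _, _, _ => rfl
  | j + 1, k, h, s, hθ, hs => by
    simp only [value, backup]
    refine Finset.sum_congr rfl fun a _ => ?_
    rw [hθ s hs]
    congr 3
    refine Finset.sum_congr rfl fun s' hs' => ?_
    have hs'' := (Finset.mem_filter.mp hs').2
    rw [M.value_congr π j (k + 1) _ s' (fun s hs => hθ s (by omega)) (by omega)]

theorem integrable_comp_params (M : DRMDP S A)
    {Q : (s : S) → Measure (Param S (A s) × Fin (M.fmt s).N)}
    (hQ : ∀ s, Q s ∈ (M.fmt s).ambiguity) {G : ((s : S) → Param S (A s)) → ℝ}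
    (hG : Continuous G) :
    Integrable (fun ξ : M.Omega => G fun s => (ξ s).1) (Measure.pi Q) := by
  have := fun s => (hQ s).1
  choose K hK hKQ using fun s => (M.fmt s).exists_isCompact_ae_mem
  refine integrable_comp_of_ae_mem_isCompact (isCompact_univ_pi hK)
    (X := fun (ξ : M.Omega) s => (ξ s).1) (by fun_prop) ?_ hG
  have h : ∀ s, ∀ᵐ ξ ∂Measure.pi Q, (ξ s).1 ∈ K s := fun s =>
    (Measure.tendsto_eval_ae_ae (μ := Q) (i := s)).eventually (hKQ s _ (hQ s))
  filter_upwards [ae_all_iff.mpr h] with ξ hξ s _ using hξ s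

/-- Under a product law, the expected reward to go is that of the mean parameters. -/
theorem integral_value (M : DRMDP S A) (π : M.Policy)
    {Q : (s : S) → Measure (Param S (A s) × Fin (M.fmt s).N)}
    (hQ : ∀ s, Q s ∈ (M.fmt s).ambiguity) :
    ∀ (j k : ℕ) (h : Fin k → Σ s, A s) (s : S), (M.stage s : ℕ) = k →
      ∫ ξ, M.value π (fun s => (ξ s).1) j k h s ∂Measure.pi Q =
        M.value π (fun s => ∫ x, x.1 ∂Q s) j k h s
  | 0, _, _, _, _ => by simp [value]
  | j + 1, k, h, s, hs => by
    have := fun s => (hQ s).1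
    have hc := M.continuous_value π j (k + 1)
    have hr : ∀ a, Integrable (fun ξ : M.Omega => (ξ s).1.2 a) (Measure.pi Q) := fun a =>
      M.integrable_comp_params hQ (G := fun θ => (θ s).2 a) (by fun_prop)
    have hpv : ∀ a h' s', Integrable (fun ξ : M.Omega => (ξ s).1.1 a s' *
        M.value π (fun s => (ξ s).1) j (k + 1) h' s') (Measure.pi Q) := fun a h' s' =>
      M.integrable_comp_params hQ
        (G := fun θ => (θ s).1 a s' * M.value π θ j (k + 1) h' s') (by fun_prop)
    have hsum : ∀ a h', Integrable (fun ξ : M.Omega =>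
        ∑ s' with (M.stage s' : ℕ) = M.stage s + 1, (ξ s).1.1 a s' *
          M.value π (fun s => (ξ s).1) j (k + 1) h' s') (Measure.pi Q) := fun a h' =>
      integrable_finsetSum _ fun s' _ => hpv a h' s'
    have hadd : ∀ a h', Integrable (fun ξ : M.Omega => M.act π k h s a * ((ξ s).1.2 a + M.γ *
        ∑ s' with (M.stage s' : ℕ) = M.stage s + 1, (ξ s).1.1 a s' *
          M.value π (fun s => (ξ s).1) j (k + 1) h' s')) (Measure.pi Q) := fun a h' =>
      ((hr a).add ((hsum a h').const_mul M.γ)).const_mul (M.act π k h s a)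
    simp only [value, backup]
    rw [integral_finsetSum _ fun a _ => hadd a _]
    refine Finset.sum_congr rfl fun a _ => ?_
    rw [integral_const_mul, integral_add (hr a) ((hsum a _).const_mul M.γ), integral_const_mul,
      integral_finsetSum _ fun s' _ => hpv a _ s']
    congr 2
    · have h1 := integral_mul_pi_of_forall_ne Q s (f := fun x => x.1.2 a) (G := fun _ => 1)
        (by fun_prop) measurable_const fun _ _ _ => rfl
      simp only [mul_one, integral_const, probReal_univ, smul_eq_mul] at h1
      rw [h1]
      exact LiftedFormat.integral_linear (hQ s) (LinearMap.toContinuousLinearMap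
        ((LinearMap.proj a).comp (LinearMap.snd ℝ (A s → S → ℝ) (A s → ℝ))))
    · congr 1
      refine Finset.sum_congr rfl fun s' hs' => ?_
      have hs'' := (Finset.mem_filter.mp hs').2
      rw [integral_mul_pi_of_forall_ne Q s (f := fun x => x.1.1 a s')
        (G := fun ξ => M.value π (fun s => (ξ s).1) j (k + 1) _ s') (by fun_prop)
        ((hc _ s').measurable.comp (by fun_prop)),
        M.integral_value π hQ j (k + 1) _ s' (by omega)]
      · congr 1
        exact LiftedFormat.integral_linear (hQ s) (LinearMap.toContinuousLinearMap
          ((LinearMap.proj s').comp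
            ((LinearMap.proj a).comp (LinearMap.fst ℝ (A s → S → ℝ) (A s → ℝ)))))
      -- The reward to go from stage `k + 1` involves only states of stage at least `k + 1`, hence
      -- not the parameters of `s`, which lies on stage `k`. This is where the layering gives
      -- independence.
      · intro ξ ξ' hξ
        refine M.value_congr π j (k + 1) _ s' (fun t ht => ?_) (by omega)
        rw [hξ t]
        rintro rfl
        omega

/-- The trajectory sum agrees with the recursion only for admissible parameters. The support
constraints make the parameters admissible almost surely, so the integrals agree, and the integrated
recursion is evaluated at the means. -/
theorem w_pi (M : DRMDP S A) (π : M.Policy)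
    {Q : (s : S) → Measure (Param S (A s) × Fin (M.fmt s).N)}
    (hQ : ∀ s, Q s ∈ (M.fmt s).ambiguity) :
    M.w π (Measure.pi Q) = M.value π (fun s => ∫ x, x.1 ∂Q s) M.H 0 Fin.elim0 M.s₁ := by
  have := fun s => (hQ s).1
  rw [← M.integral_value π hQ M.H 0 Fin.elim0 M.s₁
    (by rw [(M.stage_eq_zero_iff _).mpr rfl]; rfl), w]
  refine integral_congr_ae ?_
  have h : ∀ s, ∀ᵐ ξ ∂Measure.pi Q, (ξ s).1 ∈ (M.fmt s).D (ξ s).2 := fun s =>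
    (Measure.tendsto_eval_ae_ae (μ := Q) (i := s)).eventually (LiftedFormat.ae_mem_D (hQ s))
  filter_upwards [ae_all_iff.mpr h] with ξ hξ
  exact M.totalReward_eq_value π (θ := fun s => (ξ s).1)
    fun s hs a => M.support_admissible s hs _ _ (hξ s) a

end DRMDP
-- Robust values and worst-case means
namespace DRMDP

variable {S : Type u} {A : S → Type v} [Fintype S] [∀ s, Fintype (A s)]

/-- The rewards `r(s, a) + γ ∑_{s'} p(s' | s, a) v(s')` of the actions in `s`, as a linear function
of the parameters. -/
def actionReward (M : DRMDP S A) (v : S → ℝ) (s : S) : Param S (A s) →L[ℝ] (A s → ℝ) :=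
  LinearMap.toContinuousLinearMap
    { toFun := fun x a =>
        x.2 a + M.γ * ∑ s' with (M.stage s' : ℕ) = M.stage s + 1, x.1 a s' * v s'
      map_add' := fun x y => by
        ext a
        simp only [Prod.snd_add, Prod.fst_add, Pi.add_apply, add_mul, Finset.sum_add_distrib]
        ring
      map_smul' := fun c x => by
        ext a
        simp only [Prod.smul_snd, Prod.smul_fst, Pi.smul_apply, smul_eq_mul, mul_assoc,
          ← Finset.mul_sum, RingHom.id_apply]
        ring }

theorem integral_stageReward (M : DRMDP S A) (v : S → ℝ) (s : S) (ρ : stdSimplex ℝ (A s))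
    {P} (hP : P ∈ (M.fmt s).ambiguity) :
    ∫ x, M.stageReward v s ρ x.1 ∂P = M.stageReward v s ρ (∫ x, x.1 ∂P) := by
  have h := LiftedFormat.integral_linear hP
    ((∑ a, (ρ : A s → ℝ) a • ContinuousLinearMap.proj (R := ℝ) (φ := fun _ : A s => ℝ) a).comp
      (M.actionReward v s))
  simpa [actionReward, stageReward] using h

theorem continuous_stageReward (M : DRMDP S A) (v : S → ℝ) (s : S) (ρ : stdSimplex ℝ (A s)) :
    Continuous (M.stageReward v s ρ) := by
  unfold stageReward
  fun_prop

/-- The stage reward is linear in the parameters, so its expectation depends on the law only through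
the mean. The infimum over laws is thus a minimum of a continuous function over the compact
`meanSet`. -/
theorem exists_worstStage_eq (M : DRMDP S A) {s : S} (hG : (M.fmt s).ambiguity.Nonempty)
    (v : S → ℝ) (ρ : stdSimplex ℝ (A s)) :
    ∃ y ∈ (M.fmt s).meanSet, M.worstStage v s ρ = M.stageReward v s ρ y ∧
      ∀ y' ∈ (M.fmt s).meanSet, M.stageReward v s ρ y ≤ M.stageReward v s ρ y' := by
  obtain ⟨y, hy, hmin⟩ := (M.fmt s).isCompact_meanSet.exists_isMinOn
    (LiftedFormat.meanSet_nonempty hG) (M.continuous_stageReward v s ρ).continuousOn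
  refine ⟨y, hy, ?_, fun y' hy' => hmin hy'⟩
  have hle : ∀ P : (M.fmt s).ambiguity,
      M.stageReward v s ρ y ≤ ∫ x, M.stageReward v s ρ x.1 ∂P.1 := fun P => by
    rw [M.integral_stageReward v s ρ P.2]
    exact hmin (LiftedFormat.integral_mem_meanSet P.2)
  have : Nonempty (M.fmt s).ambiguity := hG.to_subtype
  obtain ⟨P, hP, rfl⟩ := LiftedFormat.exists_integral_eq_of_mem_meanSet hy
  refine le_antisymm ?_ (le_ciInf hle)
  refine (ciInf_le ⟨_, Set.forall_mem_range.mpr hle⟩ ⟨P, hP⟩).trans ?_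
  exact (M.integral_stageReward v s ρ hP).le

theorem worstStage_le (M : DRMDP S A) {s : S} (v : S → ℝ) (ρ : stdSimplex ℝ (A s))
    {y : Param S (A s)} (hy : y ∈ (M.fmt s).meanSet) :
    M.worstStage v s ρ ≤ M.stageReward v s ρ y := by
  obtain ⟨P, hP, -⟩ := LiftedFormat.exists_integral_eq_of_mem_meanSet hy
  obtain ⟨z, -, hz, hmin⟩ := M.exists_worstStage_eq ⟨P, hP⟩ v ρ
  exact hz.trans_le (hmin y hy)

theorem robustValue_eq_worstStage (M : DRMDP S A) {s : S} {j : ℕ}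
    (hj : M.stage s + (j + 1) = M.H) {ρ : stdSimplex ℝ (A s)} (hρ : M.IsRobustAction s ρ) :
    M.robustValue (j + 1) s = M.worstStage (M.robustValue j) s ρ := by
  have hj' : M.H - (M.stage s + 1) = j := by omega
  rw [IsRobustAction, hj'] at hρ
  have : Nonempty (stdSimplex ℝ (A s)) := ⟨ρ⟩
  -- The robust action itself supplies the upper bound needed for the real supremum, which it
  -- attains.
  exact le_antisymm (ciSup_le hρ) (le_ciSup (f := M.worstStage (M.robustValue j) s)
    ⟨_, Set.forall_mem_range.mpr hρ⟩ ρ)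

/-- There are worst-case mean parameters against which no action does better than the
`S`-robust value. -/
theorem exists_actionReward_le (M : DRMDP S A) {s : S} (hG : (M.fmt s).ambiguity.Nonempty)
    {j : ℕ} (hj : M.stage s + (j + 1) = M.H) {ρ : stdSimplex ℝ (A s)}
    (hρ : M.IsRobustAction s ρ) :
    ∃ y ∈ (M.fmt s).meanSet, ∀ a,
      M.actionReward (M.robustValue j) s y a ≤ M.robustValue (j + 1) s := by
  refine exists_forall_le_of_forall_stdSimplex (M.fmt s).isCompact_meanSet
    (M.fmt s).convex_meanSet (LiftedFormat.meanSet_nonempty hG) _ _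
    fun ρ' hρ' => ?_
  obtain ⟨y, hy, hyw, -⟩ := M.exists_worstStage_eq hG (M.robustValue j) ⟨ρ', hρ'⟩
  refine ⟨y, hy, hyw.symm.trans_le ?_⟩
  rw [M.robustValue_eq_worstStage hj hρ]
  have hj' : M.H - (M.stage s + 1) = j := by omega
  rw [IsRobustAction, hj'] at hρ
  exact hρ _

theorem transition_nonneg_of_mem_meanSet (M : DRMDP S A) {s : S} (hs : (M.stage s : ℕ) < M.H)
    {y : Param S (A s)} (hy : y ∈ (M.fmt s).meanSet) (a : A s) (s' : S) : 0 ≤ y.1 a s' := by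
  obtain ⟨z, hz, rfl⟩ := hy
  simp only [Prod.fst_sum, Finset.sum_apply, Prod.smul_fst, Pi.smul_apply, smul_eq_mul]
  exact Finset.sum_nonneg fun n _ =>
    mul_nonneg (hz.pos n).le ((M.support_admissible s hs n _ (hz.1.2.1 n) a).1 s')

theorem backup_mono (M : DRMDP S A) (π : M.Policy) {θ : (s : S) → Param S (A s)} {k : ℕ}
    {g g' : (Fin (k + 1) → Σ s, A s) → S → ℝ} (h : Fin k → Σ s, A s) {s : S}
    (hθ : ∀ a s', 0 ≤ (θ s).1 a s')
    (hg : ∀ h' s', (M.stage s' : ℕ) = M.stage s + 1 → g h' s' ≤ g' h' s') :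
    M.backup π θ k g h s ≤ M.backup π θ k g' h s :=
  Finset.sum_le_sum fun a _ => mul_le_mul_of_nonneg_left
    (add_le_add le_rfl (mul_le_mul_of_nonneg_left (Finset.sum_le_sum fun s' hs' =>
      mul_le_mul_of_nonneg_left (hg _ s' (Finset.mem_filter.mp hs').2) (hθ a s')) M.γ_pos.le))
    (M.act_nonneg π k h s a)

/-- Nonnegative transitions allow the reward to go to be replaced by the next robust value. Against
the worst-case means every action is then bounded by the current robust value, and so is any
mixture, whatever the history. -/
theorem value_le_robustValue (M : DRMDP S A) (π : M.Policy) {θ : (s : S) → Param S (A s)}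
    (hθ : ∀ s, θ s ∈ (M.fmt s).meanSet)
    (hworst : ∀ j s, M.stage s + (j + 1) = M.H → ∀ a,
      M.actionReward (M.robustValue j) s (θ s) a ≤ M.robustValue (j + 1) s) :
    ∀ (j k : ℕ) (h : Fin k → Σ s, A s) (s : S), k + j = M.H → (M.stage s : ℕ) = k →
      M.value π θ j k h s ≤ M.robustValue j s
  | 0, _, _, _, _, _ => le_rfl
  | j + 1, k, h, s, hj, hs => by
    calc M.value π θ (j + 1) k h s
        ≤ M.backup π θ k (fun _ s' => M.robustValue j s') h s :=
          M.backup_mono π h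
            (fun a s' => M.transition_nonneg_of_mem_meanSet (by omega) (hθ s) a s')
            fun h' s' hs' => M.value_le_robustValue π hθ hworst j (k + 1) h' s' (by omega)
              (by omega)
      _ = ∑ a, M.act π k h s a * M.actionReward (M.robustValue j) s (θ s) a := rfl
      _ ≤ ∑ a, M.act π k h s a * M.robustValue (j + 1) s :=
          Finset.sum_le_sum fun a _ => mul_le_mul_of_nonneg_left (hworst j s (by omega) a)
            (M.act_nonneg π k h s a)
      _ = M.robustValue (j + 1) s := by
          rw [← Finset.sum_mul, M.sum_act π (by omega), one_mul]

/-- The mirror image of the previous bound: after every history the prescribed mixture guarantees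
the robust value against any mean, not just the worst one. -/
theorem robustValue_le_value (M : DRMDP S A) {π : M.Policy} (hπ : M.IsSRobust π)
    {θ : (s : S) → Param S (A s)} (hθ : ∀ s, θ s ∈ (M.fmt s).meanSet) :
    ∀ (j k : ℕ) (h : Fin k → Σ s, A s) (s : S), k + j = M.H → (M.stage s : ℕ) = k →
      M.robustValue j s ≤ M.value π θ j k h s
  | 0, _, _, _, _, _ => le_rfl
  | j + 1, k, h, s, hj, hs => by
    have hk : k < M.H := by omega
    calc M.robustValue (j + 1) s
        = M.worstStage (M.robustValue j) s (π ⟨k, hk⟩ h s) :=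
          M.robustValue_eq_worstStage (by omega) (hπ ⟨k, hk⟩ h s (Fin.ext hs))
      _ ≤ M.stageReward (M.robustValue j) s (π ⟨k, hk⟩ h s) (θ s) := M.worstStage_le _ _ (hθ s)
      _ = M.backup π θ k (fun _ s' => M.robustValue j s') h s := by
          simp only [stageReward, backup, M.act_of_lt π hk]
      _ ≤ M.value π θ (j + 1) k h s :=
          M.backup_mono π h
            (fun a s' => M.transition_nonneg_of_mem_meanSet (by omega) (hθ s) a s')
            fun h' s' hs' => M.robustValue_le_value hπ hθ j (k + 1) h' s' (by omega) (by omega)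

/-- An infimum of an unbounded family of reals would default to zero. Here the rewards are values of
a continuous function on a product of compact mean sets. -/
theorem bddBelow_w (M : DRMDP S A) (π : M.Policy) :
    BddBelow (Set.range fun P : M.ambiguity => M.w π P) := by
  obtain ⟨C, hC⟩ := ((isCompact_univ_pi fun s => (M.fmt s).isCompact_meanSet).image
    (M.continuous_value π M.H 0 Fin.elim0 M.s₁)).bddBelow
  refine ⟨C, ?_⟩
  rintro _ ⟨⟨_, Q, hQ, rfl⟩, rfl⟩
  refine hC ⟨fun s => ∫ x, x.1 ∂Q s, fun s _ => LiftedFormat.integral_mem_meanSet (hQ s), ?_⟩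
  exact (M.w_pi π hQ).symm

/-- The worst-case law of an `S`-robust strategy: no policy earns more than the `S`-robust value
under it. -/
theorem exists_ambiguity_w_le [∀ s, Nonempty (A s)] (M : DRMDP S A)
    (hG : ∀ s, (M.fmt s).ambiguity.Nonempty) {π' : M.Policy} (hπ' : M.IsSRobust π') :
    ∃ P ∈ M.ambiguity, ∀ π, M.w π P ≤ M.robustValue M.H M.s₁ := by
  have hy : ∀ s, ∃ y ∈ (M.fmt s).meanSet, ∀ j, M.stage s + (j + 1) = M.H → ∀ a,
      M.actionReward (M.robustValue j) s y a ≤ M.robustValue (j + 1) s := by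
    intro s
    by_cases hs : (M.stage s : ℕ) < M.H
    · obtain ⟨j, hj⟩ : ∃ j, M.stage s + (j + 1) = M.H := ⟨M.H - M.stage s - 1, by omega⟩
      obtain ⟨y, hy, hya⟩ := M.exists_actionReward_le (hG s) hj
        -- Any history will do: it only serves to extract from `π'` a robust action at `s`, and the
        -- nonempty action set provides one.
        (hπ' ⟨M.stage s, hs⟩ (fun _ => ⟨s, Classical.arbitrary _⟩) s rfl)
      refine ⟨y, hy, fun i hi => ?_⟩
      obtain rfl : i = j := by omega
      exact hya
    -- At the last stage no decision remains and the condition is vacuous, so any attainable mean is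
    -- allowed.
    · obtain ⟨P, hP⟩ := hG s
      exact ⟨_, LiftedFormat.integral_mem_meanSet hP, fun j hj => by omega⟩
  choose y hy hya using hy
  choose Q hQ hQy using fun s => LiftedFormat.exists_integral_eq_of_mem_meanSet (hy s)
  refine ⟨Measure.pi Q, ⟨Q, hQ, rfl⟩, fun π => ?_⟩
  rw [M.w_pi π hQ]
  simp only [hQy]
  exact M.value_le_robustValue π hy (fun j s => hya s j) M.H 0 _ _ (zero_add _)
    (by rw [(M.stage_eq_zero_iff _).mpr rfl]; rfl)

theorem robustValue_le_w (M : DRMDP S A) {π : M.Policy} (hπ : M.IsSRobust π) {P}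
    (hP : P ∈ M.ambiguity) : M.robustValue M.H M.s₁ ≤ M.w π P := by
  obtain ⟨Q, hQ, rfl⟩ := hP
  rw [M.w_pi π hQ]
  exact M.robustValue_le_value hπ (fun s => LiftedFormat.integral_mem_meanSet (hQ s)) M.H 0 _ _
    (zero_add _) (by rw [(M.stage_eq_zero_iff _).mpr rfl]; rfl)

end DRMDP
end RobustMDP
end

/-! ### The saddle point -/

theorem mainTheorem1 {S : Type*} {A : S → Type*} [Fintype S] [∀ s, Fintype (A s)]
    [∀ s, Nonempty (A s)] (M : RobustMDP.DRMDP S A)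
    (hG : ∀ s, (M.fmt s).ambiguity.Nonempty)
    (πstar : M.Policy) (hπ : M.IsSRobust πstar) :
    M.IsDistributionallyRobust πstar ∧
      ∃ Pstar ∈ M.ambiguity,
        IsGreatest (Set.range fun π : M.Policy => M.w π Pstar) (M.w πstar Pstar) ∧
        IsLeast ((fun P => M.w πstar P) '' M.ambiguity) (M.w πstar Pstar) := by
  obtain ⟨P, hP, hle⟩ := M.exists_ambiguity_w_le hG hπ
  have hge := fun {P} (hP : P ∈ M.ambiguity) => M.robustValue_le_w hπ hP
  have : Nonempty M.ambiguity := ⟨⟨P, hP⟩⟩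
  refine ⟨fun π => ?_, P, hP, ⟨⟨πstar, rfl⟩, ?_⟩, ⟨⟨P, hP, rfl⟩, ?_⟩⟩
  · exact ((ciInf_le (M.bddBelow_w π) ⟨P, hP⟩).trans (hle π)).trans
      (le_ciInf fun P' => hge P'.2)
  · rintro _ ⟨π, rfl⟩
    exact (hle π).trans (hge hP)
  · rintro _ ⟨P', hP', rfl⟩
    exact (hle πstar).trans (hge hP')
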